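/- Let $K,A,B$ be nonempty finite sets, let $M_k\in\mathbb R^{A\times B}$ for $k\in K$, and for each $a\in A$ let $Q_a\in\mathbb R^{K\times K}$ be a row-stochastic matrix. Let $\Delta(X)$ be the set of probability distributions on a finite set $X$, and let $n\ge 1$. A behavior strategy $\sigma\in\Sigma_n$ of player 1 (informed) consists of maps $\sigma_t:K^t\times A^{t-1}\times B^{t-1}\to\Delta(A)$, and a behavior strategy $\tau\in\mathcal T_n$ of player 2 (uninformed) consists of maps $\tau_t:A^{t-1}\times B^{t-1}\to\Delta(B)$, $1\le t\le n$. For $p\in\Delta(K)$, the play $(k_t,a_t,b_t)_{t=1}^n$ has the law $\mathbf P_{p,\sigma,\tau}$ under which $k_1\sim p$; given $k_1,\dots,k_t,a_1,\dots,a_{t-1},b_1,\dots,b_{t-1}$, the actions $a_t\sim\sigma_t(k_1,\dots,k_t,a_1,\dots,a_{t-1},b_1,\dots,b_{t-1})$ and $b_t\sim\tau_t(a_1,\dots,a_{t-1},b_1,\dots,b_{t-1})$ are independent; and $k_{t+1}\sim Q_{a_t}(k_t,\cdot)$ given the play up to stage $t$. The primal game $\Gamma_n(p)$ is the zero-sum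 game in which player 1 chooses $\sigma\in\Sigma_n$, player 2 chooses $\tau\in\mathcal T_n$, and player 1, who maximizes, receives $\gamma_n(p,\sigma,\tau)=\mathbf E_{p,\sigma,\tau}\big[\sum_{t=1}^n M_{k_t}(a_t,b_t)\big]$. For $\alpha\in\mathbb R^K$, the dual game $G_n(\alpha)$ is the zero-sum game in which player 1 chooses $(p,\sigma)\in\Delta(K)\times\Sigma_n$, player 2 chooses $\tau\in\mathcal T_n$, and player 1 receives $\mathbf E_{p,\sigma,\tau}\big[\alpha(k_1)+\sum_{t=1}^n M_{k_t}(a_t,b_t)\big]$. Theorem. For every $p\in\Delta(K)$ and every $\alpha\in\mathbb R^K$ the games $\Gamma_n(p)$ and $G_n(\alpha)$ have values $v_n(p)$ and $w_n(\alpha)$, that is, in each game $\max\min=\min\max$, with all extrema attained. Moreover $$v_n(p)=\min_{\alpha\in\mathbb R^K}\{w_n(\alpha)-p^{\mathsf T}\alpha\}\quad\text{for every } p\in\Delta(K),$$ $$w_n(\alpha)=\max_{p\in\Delta(K)}\{v_n(p)+p^{\mathsf T}\alpha\}\quad\text{for every }\alpha\in\mathbb R^K.$$ Finally, let $p\in\Delta(K)$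 and let $\tau^*$ be any security strategy of player 2 in $\Gamma_n(p)$, that is, $\max_{\sigma\in\Sigma_n}\gamma_n(p,\sigma,\tau^*)=\min_{\tau\in\mathcal T_n}\max_{\sigma\in\Sigma_n}\gamma_n(p,\sigma,\tau)$. Then the initial regret $\hat\alpha_0\in\mathbb R^K$, given by $\hat\alpha_0(k)=-\max_{\sigma\in\Sigma_n}\gamma_n(\delta_k,\sigma,\tau^*)$, where $\delta_k$ is the point mass at $k$ (so that $\gamma_n(\delta_k,\sigma,\tau^*)$ is the expected total payoff given $k_1=k$), attains the minimum in the formula for $v_n(p)$. -/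

import Mathlib

open Set

noncomputable section

namespace AsymGame

/-! ### Zero-sum games in normal form

`f s t` is the payoff of the maximizing player when the maximizer plays `s` and the minimizer
plays `t`. -/

/-- The maxmin value `max_s min_t f s t`. -/
def lowerValue {S T : Type*} (f : S → T → ℝ) : ℝ := ⨆ s, ⨅ t, f s t

/-- The minmax value `min_t max_s f s t`. -/
def upperValue {S T : Type*} (f : S → T → ℝ) : ℝ := ⨅ t, ⨆ s, f s t

/-- `v` is the value of the game: the inner and outer extrema in `max_s min_t f s t` and in
`min_t max_s f s t` are all attained, and both numbers are equal to `v`. -/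
structure HasValue {S T : Type*} (f : S → T → ℝ) (v : ℝ) : Prop where
  min_attained : ∀ s, ∃ t, IsMinOn (f s) univ t
  max_attained : ∀ t, ∃ s, IsMaxOn (fun s' => f s' t) univ s
  maxmin : IsGreatest (range fun s => ⨅ t, f s t) v
  minmax : IsLeast (range fun t => ⨆ s, f s t) v

/-- A strategy of the minimizer that guarantees the minmax value. -/
def IsMinimizerSecurity {S T : Type*} (f : S → T → ℝ) (t : T) : Prop :=
  ⨆ s, f s t = upperValue f

/-! ### The stochastic game -/

/-- The data of a stochastic game with a single controller: payoff matrices `M k` and, for every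
action `a` of player 1, a row-stochastic transition matrix `Q a`. -/
structure Game (K A B : Type*) [Fintype K] where
  /-- payoff of player 1 -/
  M : K → Matrix A B ℝ
  /-- transition matrices -/
  Q : A → Matrix K K ℝ
  Q_mem : ∀ a k, Q a k ∈ stdSimplex ℝ K

/-- Behavior strategies of player 1 in `n` stages. The stages are numbered from `0`, so that at
stage `t` there are `t + 1` observed states and `t` past actions of either player. -/
abbrev Strategy₁ (K A B : Type*) [Fintype A] (n : ℕ) : Type _ :=
  (t : Fin n) → (Fin (t + 1) → K) → (Fin t → A) → (Fin t → B) → stdSimplex ℝ A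

/-- Behavior strategies of player 2 in `n` stages. -/
abbrev Strategy₂ (A B : Type*) [Fintype B] (n : ℕ) : Type _ :=
  (t : Fin n) → (Fin t → A) → (Fin t → B) → stdSimplex ℝ B

/-- Plays of `n` stages: sequences of state, action of player 1, action of player 2. -/
abbrev Play (K A B : Type*) (n : ℕ) : Type _ := Fin n → K × A × B

namespace Play

variable {K A B : Type*} {n : ℕ}

/-- The states up to and including stage `t`. -/
def states (ω : Play K A B n) (t : Fin n) : Fin (t + 1) → K :=
  fun i => (ω (Fin.castLE t.isLt i)).1

/-- The actions of player 1 before stage `t`. -/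
def acts₁ (ω : Play K A B n) (t : Fin n) : Fin t → A :=
  fun i => (ω (Fin.castLE t.isLt.le i)).2.1

/-- The actions of player 2 before stage `t`. -/
def acts₂ (ω : Play K A B n) (t : Fin n) : Fin t → B :=
  fun i => (ω (Fin.castLE t.isLt.le i)).2.2

end Play

namespace Game

variable {K A B : Type*} [Fintype K] [Fintype A] [Fintype B] {n : ℕ}

/-- Conditional probability of the state of stage `t` given the past: the initial distribution
at the first stage, the transition law afterwards. -/
def stateProb (G : Game K A B) (p : stdSimplex ℝ K) (ω : Play K A B n) : Fin n → ℝ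
  | ⟨0, h⟩ => p.1 (ω ⟨0, h⟩).1
  | ⟨t + 1, h⟩ =>
      G.Q (ω ⟨t, Nat.lt_of_succ_lt h⟩).2.1 (ω ⟨t, Nat.lt_of_succ_lt h⟩).1 (ω ⟨t + 1, h⟩).1

/-- The probability of the play `ω` under the initial distribution `p` and the strategies
`σ`, `τ`. -/
def playProb (G : Game K A B) (p : stdSimplex ℝ K) (σ : Strategy₁ K A B n)
    (τ : Strategy₂ A B n) (ω : Play K A B n) : ℝ :=
  ∏ t : Fin n, G.stateProb p ω t
    * (σ t (ω.states t) (ω.acts₁ t) (ω.acts₂ t)).1 (ω t).2.1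
    * (τ t (ω.acts₁ t) (ω.acts₂ t)).1 (ω t).2.2

/-- The expectation of `X` over the plays. -/
def expect (G : Game K A B) (p : stdSimplex ℝ K) (σ : Strategy₁ K A B n)
    (τ : Strategy₂ A B n) (X : Play K A B n → ℝ) : ℝ :=
  ∑ ω, G.playProb p σ τ ω * X ω

/-- The sum of the stage payoffs along a play. -/
def total (G : Game K A B) (ω : Play K A B n) : ℝ :=
  ∑ t : Fin n, G.M (ω t).1 (ω t).2.1 (ω t).2.2

/-- The total payoff of the primal game with initial distribution `p`. -/
def payoff (G : Game K A B) (p : stdSimplex ℝ K) (σ : Strategy₁ K A B n)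
    (τ : Strategy₂ A B n) : ℝ :=
  G.expect p σ τ G.total

/-- The total payoff of the dual game with initial vector payoff `α`. A strategy of player 1 is
a distribution of the initial state together with a behavior strategy. -/
def dualPayoff [NeZero n] (G : Game K A B) (α : K → ℝ)
    (s : stdSimplex ℝ K × Strategy₁ K A B n) (τ : Strategy₂ A B n) : ℝ :=
  G.expect s.1 s.2 τ fun ω => α (ω 0).1 + G.total ω

/-- The value of the `n`-stage primal game. -/
def value (G : Game K A B) (n : ℕ) (p : stdSimplex ℝ K) : ℝ :=
  lowerValue (G.payoff (n := n) p)

/-- The value of the `n`-stage dual game. -/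
def dualValue (G : Game K A B) (n : ℕ) [NeZero n] (α : K → ℝ) : ℝ :=
  lowerValue (G.dualPayoff (n := n) α)

open Classical in
/-- The point mass at `k`. -/
def pointMass (k : K) : stdSimplex ℝ K := ⟨Pi.single k 1, single_mem_stdSimplex ℝ k⟩

/-- The vector of minus the worst expected total payoffs against `τ`, given the initial state.
The conditional law of the play given that the initial state is `k` is the law of the play
started from the point mass at `k`. This vector is the initial regret of the primal game when `τ`
is a security strategy of player 2. -/
def regret (G : Game K A B) (τ : Strategy₂ A B n) (k : K) : ℝ :=
  -⨆ σ : Strategy₁ K A B n, G.payoff (pointMass k) σ τ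

end Game

end AsymGame

end

/-! The probability of a play factors as `p(k₁)` times a plan of player 1, a plan of player 2 and
the transition factors (`playProb_eq`). Payoffs are therefore bilinear in the plans, though not in
the behavior strategies. Perfect recall makes the sets of plans convex (`exists_realization_mix`, a
form of Kuhn's theorem), and they are compact as continuous images of products of simplices. Sion's
theorem then gives the values of both games.

For the duality, the dual payoff is the primal payoff plus `p ⬝ᵥ α`, a term free of `τ`. Maximizing
over `σ` and then over `p` gives the formula for the dual value, and hence `v(p) ≤ w(α) - p ⬝ᵥ α`
for every `α`. Equality is attained explicitly: the informed player can optimize separately in each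
initial state, so the best reply payoff to `τ` is the linear function `-(p ⬝ᵥ G.regret τ)` of `p`
(`iSup_payoff`). It bounds `v` from above, so `w(G.regret τ) ≤ 0`; when `τ` is a security strategy
at `p`, the bound is tight there. -/

open Finset in
/-- A minimax theorem for payoffs that are bilinear in finite-dimensional images of the strategies,
when these images are convex. -/
theorem AsymGame.hasValue_of_bilinear {S T Ω : Type*} [Fintype Ω]
    [TopologicalSpace S] [CompactSpace S] [Nonempty S]
    [TopologicalSpace T] [CompactSpace T] [Nonempty T]
    {x : S → Ω → ℝ} {y : T → Ω → ℝ} (hx : Continuous x) (hy : Continuous y)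
    (cx : Convex ℝ (Set.range x)) (cy : Convex ℝ (Set.range y)) (c : Ω → ℝ) {f : S → T → ℝ}
    (hf : ∀ s t, f s t = ∑ ω, x s ω * y t ω * c ω) : HasValue f (lowerValue f) := by
  have hmin : ∀ s, ∃ t, IsMinOn (f s) univ t := fun s => by
    have hc : Continuous (f s) := by
      simp only [funext (hf s)]
      fun_prop
    obtain ⟨t, -, ht⟩ := isCompact_univ.exists_isMinOn univ_nonempty hc.continuousOn
    exact ⟨t, ht⟩
  have hmax : ∀ t, ∃ s, IsMaxOn (fun s' => f s' t) univ s := fun t => by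
    have hc : Continuous fun s => f s t := by
      simp only [hf]
      fun_prop
    obtain ⟨s, -, hs⟩ := isCompact_univ.exists_isMaxOn univ_nonempty hc.continuousOn
    exact ⟨s, hs⟩
  have hbelow : ∀ s, BddBelow (Set.range (f s)) := fun s => by
    obtain ⟨t, ht⟩ := hmin s
    exact ⟨f s t, by rintro _ ⟨t', rfl⟩; exact ht (mem_univ t')⟩
  have habove : ∀ t, BddAbove (Set.range fun s => f s t) := fun t => by
    obtain ⟨s, hs⟩ := hmax t
    exact ⟨f s t, by rintro _ ⟨s', rfl⟩; exact hs (mem_univ s')⟩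
  -- Sion's theorem minimizes over its first set, hence the swapped roles of `x` and `y`.
  obtain ⟨_, ⟨t₀, rfl⟩, _, ⟨s₀, rfl⟩, h⟩ := Sion.exists_isSaddlePointOn
    (X := Set.range y) (Y := Set.range x) (f := fun v u => ∑ ω, u ω * v ω * c ω)
    (Set.range_nonempty y) cy (isCompact_range hy)
    (fun u _ => (by fun_prop : Continuous fun v : Ω → ℝ =>
      ∑ ω, u ω * v ω * c ω).lowerSemicontinuous.lowerSemicontinuousOn _)
    (fun u _ => ConvexOn.quasiconvexOn ⟨cy, fun v _ v' _ a b _ _ _ => le_of_eq <| by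
      simp only [Pi.add_apply, Pi.smul_apply, smul_eq_mul, mul_sum, ← sum_add_distrib]
      exact sum_congr rfl fun ω _ => by ring⟩)
    cx (Set.range_nonempty x) (isCompact_range hx)
    (fun v _ => (by fun_prop : Continuous fun u : Ω → ℝ =>
      ∑ ω, u ω * v ω * c ω).upperSemicontinuous.upperSemicontinuousOn _)
    (fun v _ => ConcaveOn.quasiconcaveOn ⟨cx, fun u _ u' _ a b _ _ _ => le_of_eq <| by
      simp only [Pi.add_apply, Pi.smul_apply, smul_eq_mul, mul_sum, ← sum_add_distrib]
      exact sum_congr rfl fun ω _ => by ring⟩)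
  have hs : ∀ s t, f s t₀ ≤ f s₀ t := fun s t => by
    rw [hf, hf]
    exact h _ ⟨t, rfl⟩ _ ⟨s, rfl⟩
  have hg : IsGreatest (Set.range fun s => ⨅ t, f s t) (f s₀ t₀) :=
    ⟨⟨s₀, le_antisymm (ciInf_le (hbelow _) _) (le_ciInf fun t => hs s₀ t)⟩, by
      rintro _ ⟨s, rfl⟩
      exact (ciInf_le (hbelow _) t₀).trans (hs s t₀)⟩
  have hl : IsLeast (Set.range fun t => ⨆ s, f s t) (f s₀ t₀) :=
    ⟨⟨t₀, le_antisymm (ciSup_le fun s => hs s t₀) (le_ciSup (habove t₀) s₀)⟩, by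
      rintro _ ⟨t, rfl⟩
      exact (hs s₀ t).trans (le_ciSup (habove t) s₀)⟩
  have hv : lowerValue f = f s₀ t₀ := hg.csSup_eq
  exact ⟨hmin, hmax, hv ▸ hg, hv ▸ hl⟩

namespace AsymGame

namespace HasValue

variable {S T : Type*} {f : S → T → ℝ} {v : ℝ}

theorem bddBelow (h : HasValue f v) (s : S) : BddBelow (range (f s)) := by
  obtain ⟨t, ht⟩ := h.min_attained s
  exact ⟨f s t, by rintro _ ⟨t', rfl⟩; exact ht (mem_univ t')⟩

theorem bddAbove (h : HasValue f v) (t : T) : BddAbove (range fun s => f s t) := by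
  obtain ⟨s, hs⟩ := h.max_attained t
  exact ⟨f s t, by rintro _ ⟨s', rfl⟩; exact hs (mem_univ s')⟩

theorem upperValue_eq (h : HasValue f v) : upperValue f = v := h.minmax.csInf_eq

end HasValue

/-! ### Mixtures of behavior strategies -/

/-- Normalize the weights; the form without division also covers weights that are both zero, where
any `ρ` serves. -/
theorem exists_stdSimplex_mix {C : Type*} [Fintype C] {a b : ℝ} (ha : 0 ≤ a) (hb : 0 ≤ b)
    (μ ν : stdSimplex ℝ C) :
    ∃ ρ : stdSimplex ℝ C, ∀ c, (a + b) * ρ.1 c = a * μ.1 c + b * ν.1 c := by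
  rcases (add_nonneg ha hb).eq_or_lt' with h | h
  · obtain ⟨rfl, rfl⟩ := (add_eq_zero_iff_of_nonneg ha hb).1 h
    exact ⟨μ, fun c => by simp⟩
  · refine ⟨⟨(a / (a + b)) • μ.1 + (b / (a + b)) • ν.1,
      convex_stdSimplex ℝ C μ.2 ν.2 (by positivity) (by positivity)
        (by field_simp)⟩, fun c => ?_⟩
    simp only [Pi.add_apply, Pi.smul_apply, smul_eq_mul]
    field_simp

section Realization

variable {Ω C : Type*} [Fintype C] {n : ℕ} {O : Fin n → Type*}

/-- The weight that the behavior strategy `σ` gives to its own actions along `ω`, when `obs t ω`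
is what the player observes before stage `t` and `act t ω` is the action of stage `t`. -/
def realization (obs : ∀ t, Ω → O t) (act : Fin n → Ω → C) (σ : ∀ t, O t → stdSimplex ℝ C)
    (ω : Ω) : ℝ :=
  ∏ t, (σ t (obs t ω)).1 (act t ω)

/-- Under perfect recall, a mixture of two behavior strategies, with weights that the player
observes, is realized by a behavior strategy. -/
theorem exists_realization_mix (obs : ∀ t, Ω → O t) (act : Fin n → Ω → C) {w w' : Ω → ℝ}
    (hw : ∀ ω, 0 ≤ w ω) (hw' : ∀ ω, 0 ≤ w' ω)
    (hwobs : ∀ t ω ω', obs t ω = obs t ω' → w ω = w ω' ∧ w' ω = w' ω')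
    (hrecall : ∀ t ω ω', obs t ω = obs t ω' →
      ∀ s < t, obs s ω = obs s ω' ∧ act s ω = act s ω')
    (σ σ' : ∀ t, O t → stdSimplex ℝ C) :
    ∃ ρ : ∀ t, O t → stdSimplex ℝ C, ∀ ω,
      (w ω + w' ω) * realization obs act ρ ω =
        w ω * realization obs act σ ω + w' ω * realization obs act σ' ω := by
  -- The realization weight of the stages before `m`.
  let P (σ : ∀ t, O t → stdSimplex ℝ C) (m : ℕ) (ω : Ω) : ℝ :=
    ∏ s : Fin n with s.1 < m, (σ s (obs s ω)).1 (act s ω)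
  have hP : ∀ σ m ω, 0 ≤ P σ m ω := fun σ m ω => Finset.prod_nonneg fun s _ => (σ s _).2.1 _
  have hPobs : ∀ σ (t : Fin n) ω ω', obs t ω = obs t ω' → P σ t ω = P σ t ω' :=
    fun σ t ω ω' h => Finset.prod_congr rfl fun s hs => by
      obtain ⟨h₁, h₂⟩ := hrecall t ω ω' h s (Finset.mem_filter.1 hs).2
      rw [h₁, h₂]
  -- After observing `o`, mix the two actions with the posterior weights of the two strategies. By
  -- perfect recall these weights depend on `o` alone, so one `ρ` serves every `ω` compatible with
  -- `o`.
  have key : ∀ t (o : O t), ∃ ρ : stdSimplex ℝ C, ∀ ω, obs t ω = o → ∀ c,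
      (w ω * P σ t ω + w' ω * P σ' t ω) * ρ.1 c =
        w ω * P σ t ω * (σ t o).1 c + w' ω * P σ' t ω * (σ' t o).1 c := by
    intro t o
    by_cases h : ∃ ω, obs t ω = o
    · obtain ⟨ω₀, rfl⟩ := h
      obtain ⟨ρ, hρ⟩ := exists_stdSimplex_mix (mul_nonneg (hw ω₀) (hP σ t ω₀))
        (mul_nonneg (hw' ω₀) (hP σ' t ω₀)) (σ t (obs t ω₀)) (σ' t (obs t ω₀))
      refine ⟨ρ, fun ω hω c => ?_⟩
      rw [(hwobs t _ _ hω).1, (hwobs t _ _ hω).2, hPobs σ t _ _ hω, hPobs σ' t _ _ hω]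
      exact hρ c
    · exact ⟨σ t o, fun ω hω => (h ⟨ω, hω⟩).elim⟩
  choose ρ hρ using key
  have hsucc : ∀ σ m (hm : m < n) ω,
      P σ (m + 1) ω = P σ m ω * (σ ⟨m, hm⟩ (obs ⟨m, hm⟩ ω)).1 (act ⟨m, hm⟩ ω) := by
    intro σ m hm ω
    have : Finset.univ.filter (fun s : Fin n => s.1 < m + 1) =
        insert ⟨m, hm⟩ (Finset.univ.filter fun s : Fin n => s.1 < m) := by
      ext s
      simp only [Finset.mem_filter, Finset.mem_univ, true_and, Finset.mem_insert, Fin.ext_iff]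
      omega
    simp only [P]
    rw [this, Finset.prod_insert (by simp), mul_comm]
  have main : ∀ m ≤ n, ∀ ω, (w ω + w' ω) * P ρ m ω = w ω * P σ m ω + w' ω * P σ' m ω := by
    intro m
    induction m with
    | zero => intro _ ω; simp [P]
    | succ m ih =>
      intro hm ω
      have h := hρ ⟨m, hm⟩ _ ω rfl (act ⟨m, hm⟩ ω)
      rw [hsucc _ _ hm, hsucc _ _ hm, hsucc _ _ hm, ← mul_assoc, ih (by omega) ω, h]
      ring
  refine ⟨ρ, fun ω => ?_⟩
  have huniv : ∀ σ, P σ n ω = realization obs act σ ω := fun σ => by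
    simp [P, realization]
  simpa only [huniv] using main n le_rfl ω

end Realization

/-- Conditional probabilities that sum to one define a law of total mass one. -/
theorem sum_prod_cond_eq_one {X : Type*} [Fintype X] {n : ℕ}
    (f : ∀ t : Fin n, (Fin t → X) → X → ℝ) (hf : ∀ t h, ∑ x, f t h x = 1) :
    ∑ ω : Fin n → X, ∏ t, f t (fun i => ω (Fin.castLE t.isLt.le i)) (ω t) = 1 := by
  induction n with
  | zero => simp
  | succ n ih =>
    -- Sum out the last coordinate first: no earlier factor depends on it.
    rw [← (Fin.snocEquiv fun _ => X).sum_comp, Fintype.sum_prod_type_right]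
    rw [← ih (fun t => f t.castSucc) fun t h => hf t.castSucc h]
    refine Finset.sum_congr rfl fun ω _ => ?_
    simp only [Fin.prod_univ_castSucc, Fin.snocEquiv_apply, Fin.snoc_last, Fin.snoc_castSucc]
    have h₁ : ∀ (t : Fin n) (x : X),
        (fun i : Fin t => (Fin.snoc (α := fun _ => X) ω x
          (Fin.castLE t.castSucc.isLt.le i) : X)) =
        fun i => ω (Fin.castLE t.isLt.le i) := fun t x => funext fun i =>
      Fin.snoc_castSucc (α := fun _ => X) x ω (Fin.castLE t.isLt.le i)
    have h₂ : ∀ x : X, (fun i : Fin n => (Fin.snoc (α := fun _ => X) ω x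
          (Fin.castLE (Fin.last n).isLt.le i) : X)) = ω := fun x => funext fun i =>
      Fin.snoc_castSucc (α := fun _ => X) x ω i
    have h₃ := hf (Fin.last n) ω
    calc _ = ∑ x, (∏ t : Fin n, f t.castSucc (fun i => ω (Fin.castLE t.isLt.le i)) (ω t))
          * f (Fin.last n) ω x := by
            refine Finset.sum_congr rfl fun x _ => ?_
            congr 1
            · exact Finset.prod_congr rfl fun t _ => congrArg (fun h => f t.castSucc h (ω t)) (h₁ t x)
            · exact congrArg (fun h => f (Fin.last n) h x) (h₂ x)
      _ = _ := by
        rw [← Finset.mul_sum, h₃, mul_one]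
        rfl

/-! ### Factorization of the law of a play -/

namespace Game

variable {K A B : Type*} [Fintype K] [Fintype A] [Fintype B] {n : ℕ}

/-- The contribution of the transitions to the probability of a play. -/
def transProb (G : Game K A B) (ω : Play K A B n) : ℝ :=
  ∏ t : Fin n, match t with
    | ⟨0, _⟩ => 1
    | ⟨t + 1, h⟩ =>
      G.Q (ω ⟨t, Nat.lt_of_succ_lt h⟩).2.1 (ω ⟨t, Nat.lt_of_succ_lt h⟩).1 (ω ⟨t + 1, h⟩).1

/-- The contribution of player 1 to the probability of a play. -/
def plan₁ (σ : Strategy₁ K A B n) (ω : Play K A B n) : ℝ :=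
  ∏ t : Fin n, (σ t (ω.states t) (ω.acts₁ t) (ω.acts₂ t)).1 (ω t).2.1

/-- The contribution of player 2 to the probability of a play. -/
def plan₂ (τ : Strategy₂ A B n) (ω : Play K A B n) : ℝ :=
  ∏ t : Fin n, (τ t (ω.acts₁ t) (ω.acts₂ t)).1 (ω t).2.2

theorem playProb_eq [NeZero n] (G : Game K A B) (p : stdSimplex ℝ K) (σ : Strategy₁ K A B n)
    (τ : Strategy₂ A B n) (ω : Play K A B n) :
    G.playProb p σ τ ω = p.1 (ω 0).1 * plan₁ σ ω * plan₂ τ ω * G.transProb ω := by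
  have h : ∏ t, G.stateProb p ω t = p.1 (ω 0).1 * G.transProb ω := by
    obtain ⟨m, rfl⟩ := Nat.exists_eq_succ_of_ne_zero (NeZero.ne n)
    rw [transProb, Fin.prod_univ_succ, Fin.prod_univ_succ (n := m)]
    exact congrArg _ (one_mul _).symm
  rw [playProb, Finset.prod_mul_distrib, Finset.prod_mul_distrib, h, plan₁, plan₂]
  ring

theorem sum_playProb (G : Game K A B) (p : stdSimplex ℝ K) (σ : Strategy₁ K A B n)
    (τ : Strategy₂ A B n) : ∑ ω, G.playProb p σ τ ω = 1 := by
  -- The state law as a function of the history alone, the form that `sum_prod_cond_eq_one`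
  -- requires.
  let st : ∀ t : Fin n, (Fin t → K × A × B) → K → ℝ := fun t h k => match t, h with
    | ⟨0, _⟩, _ => p.1 k
    | ⟨t + 1, _⟩, h => G.Q (h (Fin.last t)).2.1 (h (Fin.last t)).1 k
  have hst : ∀ t h, ∑ k, st t h k = 1 := by
    rintro ⟨_ | t, ht⟩ h
    · exact p.2.2
    · exact (G.Q_mem _ _).2
  let f : ∀ t : Fin n, (Fin t → K × A × B) → K × A × B → ℝ := fun t h x =>
    st t h x.1
      * (σ t (Fin.snoc (α := fun _ => K) (fun i => (h i).1) x.1) (fun i => (h i).2.1)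
          (fun i => (h i).2.2)).1 x.2.1
      * (τ t (fun i => (h i).2.1) (fun i => (h i).2.2)).1 x.2.2
  rw [← sum_prod_cond_eq_one f]
  · refine Finset.sum_congr rfl fun ω _ => Finset.prod_congr rfl fun t _ => ?_
    have h₁ : ω.states t = Fin.snoc (α := fun _ => K)
        (fun i => (ω (Fin.castLE t.isLt.le i)).1) (ω t).1 := by
      funext i
      refine Fin.lastCases ?_ (fun i => ?_) i
      · rw [Fin.snoc_last]; rfl
      · rw [Fin.snoc_castSucc]; rfl
    have h₂ : G.stateProb p ω t = st t (fun i => ω (Fin.castLE t.isLt.le i)) (ω t).1 := by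
      rcases t with ⟨_ | t, ht⟩ <;> rfl
    rw [h₁, h₂]
    rfl
  · intro t h
    simp only [f, Fintype.sum_prod_type, ← Finset.mul_sum]
    simp only [(τ t _ _).2.2, mul_one, ← Finset.mul_sum, (σ t _ _ _).2.2, hst]

theorem playProb_eq_sum_pointMass [NeZero n] (G : Game K A B) (p : stdSimplex ℝ K)
    (σ : Strategy₁ K A B n) (τ : Strategy₂ A B n) (ω : Play K A B n) :
    G.playProb p σ τ ω = ∑ k, p.1 k * G.playProb (pointMass k) σ τ ω := by
  classical
  simp only [playProb_eq, pointMass]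
  rw [Finset.sum_eq_single (ω 0).1 (fun k _ hk => by simp [hk.symm]) (by simp)]
  simp
  ring

theorem expect_eq_sum_pointMass [NeZero n] (G : Game K A B) (p : stdSimplex ℝ K)
    (σ : Strategy₁ K A B n) (τ : Strategy₂ A B n) (X : Play K A B n → ℝ) :
    G.expect p σ τ X = ∑ k, p.1 k * G.expect (pointMass k) σ τ X := by
  simp only [expect, Finset.mul_sum]
  rw [Finset.sum_comm]
  refine Finset.sum_congr rfl fun ω _ => ?_
  rw [playProb_eq_sum_pointMass, Finset.sum_mul]
  exact Finset.sum_congr rfl fun k _ => by ring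

theorem playProb_pointMass_of_ne [NeZero n] (G : Game K A B) {k : K} (σ : Strategy₁ K A B n)
    (τ : Strategy₂ A B n) {ω : Play K A B n} (h : (ω 0).1 ≠ k) :
    G.playProb (pointMass k) σ τ ω = 0 := by
  classical
  simp [playProb_eq, pointMass, h]

theorem expect_initial [NeZero n] (G : Game K A B) (p : stdSimplex ℝ K)
    (σ : Strategy₁ K A B n) (τ : Strategy₂ A B n) (α : K → ℝ) :
    G.expect p σ τ (fun ω => α (ω 0).1) = p.1 ⬝ᵥ α := by
  rw [expect_eq_sum_pointMass]
  refine Finset.sum_congr rfl fun k _ => congrArg _ ?_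
  calc _ = ∑ ω : Play K A B n, G.playProb (pointMass k) σ τ ω * α k := by
        refine Finset.sum_congr rfl fun ω _ => ?_
        by_cases h : (ω 0).1 = k
        · simp only [h]
        · rw [playProb_pointMass_of_ne G σ τ h, zero_mul, zero_mul]
    _ = α k := by rw [← Finset.sum_mul, sum_playProb, one_mul]

theorem dualPayoff_eq [NeZero n] (G : Game K A B) (α : K → ℝ) (p : stdSimplex ℝ K)
    (σ : Strategy₁ K A B n) (τ : Strategy₂ A B n) :
    G.dualPayoff α (p, σ) τ = G.payoff p σ τ + p.1 ⬝ᵥ α := by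
  rw [← G.expect_initial p σ τ α, payoff, dualPayoff]
  simp only [expect, mul_add, Finset.sum_add_distrib]
  ring

/-! ### Existence of values -/

-- Player 1 observes the initial state, so the weights `a * p k₁` and `b * p' k₁` are admissible in
-- `exists_realization_mix`. Allowing `p ≠ p'` is what the dual game needs.
omit [Fintype B] in
theorem exists_plan₁_mix [NeZero n] (p p' : stdSimplex ℝ K) (σ σ' : Strategy₁ K A B n)
    {a b : ℝ} (ha : 0 ≤ a) (hb : 0 ≤ b) :
    ∃ ρ : Strategy₁ K A B n, ∀ ω : Play K A B n,
      (a * p.1 (ω 0).1 + b * p'.1 (ω 0).1) * plan₁ ρ ω =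
        a * (p.1 (ω 0).1 * plan₁ σ ω) + b * (p'.1 (ω 0).1 * plan₁ σ' ω) := by
  obtain ⟨ρ, hρ⟩ := exists_realization_mix
    (O := fun t : Fin n => (Fin (t + 1) → K) × (Fin t → A) × (Fin t → B))
    (fun t (ω : Play K A B n) => (ω.states t, ω.acts₁ t, ω.acts₂ t)) (fun t ω => (ω t).2.1)
    (w := fun ω => a * p.1 (ω 0).1) (w' := fun ω => b * p'.1 (ω 0).1)
    (fun ω => mul_nonneg ha (p.2.1 _)) (fun ω => mul_nonneg hb (p'.2.1 _))
    (fun t ω ω' h => by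
      have h0 : (ω 0).1 = (ω' 0).1 := congrFun (congrArg Prod.fst h) 0
      rw [h0]
      exact ⟨rfl, rfl⟩)
    (fun t ω ω' h s hs => by
      have h₁ : ω.states t = ω'.states t := congrArg Prod.fst h
      have h₂ : ω.acts₁ t = ω'.acts₁ t := congrArg (fun x => x.2.1) h
      have h₃ : ω.acts₂ t = ω'.acts₂ t := congrArg (fun x => x.2.2) h
      have hs' : s.1 < t.1 := hs
      refine ⟨Prod.ext (funext fun i => ?_) (Prod.ext (funext fun i => ?_) (funext fun i => ?_)), ?_⟩
      · exact congrFun h₁ ⟨i, by omega⟩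
      · exact congrFun h₂ ⟨i, by omega⟩
      · exact congrFun h₃ ⟨i, by omega⟩
      · exact congrFun h₂ ⟨s, hs'⟩)
    (fun t o => σ t o.1 o.2.1 o.2.2) (fun t o => σ' t o.1 o.2.1 o.2.2)
  refine ⟨fun t k i j => ρ t (k, i, j), fun ω => (hρ ω).trans ?_⟩
  simp only [mul_assoc]
  rfl

omit [Fintype K] [Fintype A] in
theorem exists_plan₂_mix (τ τ' : Strategy₂ A B n) {a b : ℝ} (ha : 0 ≤ a) (hb : 0 ≤ b) :
    ∃ ρ : Strategy₂ A B n, ∀ ω : Play K A B n,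
      (a + b) * plan₂ ρ ω = a * plan₂ τ ω + b * plan₂ τ' ω := by
  obtain ⟨ρ, hρ⟩ := exists_realization_mix
    (O := fun t : Fin n => (Fin t → A) × (Fin t → B))
    (fun t (ω : Play K A B n) => (ω.acts₁ t, ω.acts₂ t)) (fun t ω => (ω t).2.2)
    (w := fun _ => a) (w' := fun _ => b) (fun _ => ha) (fun _ => hb)
    (fun _ _ _ _ => ⟨rfl, rfl⟩)
    (fun t ω ω' h s hs => by
      have h₂ : ω.acts₁ t = ω'.acts₁ t := congrArg Prod.fst h
      have h₃ : ω.acts₂ t = ω'.acts₂ t := congrArg Prod.snd h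
      have hs' : s.1 < t.1 := hs
      refine ⟨Prod.ext (funext fun i => ?_) (funext fun i => ?_), ?_⟩
      · exact congrFun h₂ ⟨i, by omega⟩
      · exact congrFun h₃ ⟨i, by omega⟩
      · exact congrFun h₃ ⟨s, hs'⟩)
    (fun t o => τ t o.1 o.2) (fun t o => τ' t o.1 o.2)
  exact ⟨fun t i j => ρ t (i, j), hρ⟩

omit [Fintype B] in
theorem convex_range_plan₁ [NeZero n] (p : stdSimplex ℝ K) :
    Convex ℝ (range fun (σ : Strategy₁ K A B n) (ω : Play K A B n) =>
      p.1 (ω 0).1 * plan₁ σ ω) := by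
  rintro _ ⟨σ, rfl⟩ _ ⟨σ', rfl⟩ a b ha hb hab
  obtain ⟨ρ, hρ⟩ := exists_plan₁_mix p p σ σ' ha hb
  refine ⟨ρ, funext fun ω => ?_⟩
  have := hρ ω
  rw [← add_mul, hab, one_mul] at this
  exact this

omit [Fintype B] in
theorem convex_range_dualPlan₁ [NeZero n] :
    Convex ℝ (range fun (s : stdSimplex ℝ K × Strategy₁ K A B n) (ω : Play K A B n) =>
      s.1.1 (ω 0).1 * plan₁ s.2 ω) := by
  rintro _ ⟨⟨p, σ⟩, rfl⟩ _ ⟨⟨p', σ'⟩, rfl⟩ a b ha hb hab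
  obtain ⟨ρ, hρ⟩ := exists_plan₁_mix p p' σ σ' ha hb
  exact ⟨(⟨a • p.1 + b • p'.1, convex_stdSimplex ℝ K p.2 p'.2 ha hb hab⟩, ρ), funext hρ⟩

omit [Fintype K] [Fintype A] in
theorem convex_range_plan₂ :
    Convex ℝ (range fun (τ : Strategy₂ A B n) (ω : Play K A B n) => plan₂ τ ω) := by
  rintro _ ⟨τ, rfl⟩ _ ⟨τ', rfl⟩ a b ha hb hab
  obtain ⟨ρ, hρ⟩ := exists_plan₂_mix (K := K) τ τ' ha hb
  refine ⟨ρ, funext fun ω => ?_⟩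
  have := hρ ω
  rw [hab, one_mul] at this
  exact this

omit [Fintype K] [Fintype B] in
theorem continuous_plan₁ :
    Continuous fun (σ : Strategy₁ K A B n) (ω : Play K A B n) => plan₁ σ ω := by
  refine continuous_pi fun ω => continuous_finsetProd _ fun t _ => ?_
  have h : Continuous fun σ : Strategy₁ K A B n => σ t (ω.states t) (ω.acts₁ t) (ω.acts₂ t) :=
    (continuous_apply (ω.acts₂ t)).comp <| (continuous_apply (ω.acts₁ t)).comp <|
      (continuous_apply (ω.states t)).comp (continuous_apply t)
  exact (continuous_apply _).comp (continuous_subtype_val.comp h)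

omit [Fintype K] [Fintype A] in
theorem continuous_plan₂ :
    Continuous fun (τ : Strategy₂ A B n) (ω : Play K A B n) => plan₂ τ ω := by
  refine continuous_pi fun ω => continuous_finsetProd _ fun t _ => ?_
  have h : Continuous fun τ : Strategy₂ A B n => τ t (ω.acts₁ t) (ω.acts₂ t) :=
    (continuous_apply (ω.acts₂ t)).comp <| (continuous_apply (ω.acts₁ t)).comp
      (continuous_apply t)
  exact (continuous_apply _).comp (continuous_subtype_val.comp h)

instance [Nonempty A] : Nonempty (Strategy₁ K A B n) :=
  ⟨fun _ _ _ _ => pointMass (Classical.arbitrary A)⟩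

instance [Nonempty B] : Nonempty (Strategy₂ A B n) :=
  ⟨fun _ _ _ => pointMass (Classical.arbitrary B)⟩

theorem hasValue_payoff [NeZero n] [Nonempty A] [Nonempty B] (G : Game K A B)
    (p : stdSimplex ℝ K) : HasValue (G.payoff (n := n) p) (G.value n p) := by
  have hc := continuous_plan₁ (K := K) (A := A) (B := B) (n := n)
  refine hasValue_of_bilinear (x := fun (σ : Strategy₁ K A B n) (ω : Play K A B n) =>
    p.1 (ω 0).1 * plan₁ σ ω) (by fun_prop) continuous_plan₂
    (convex_range_plan₁ p) convex_range_plan₂ (fun ω => G.transProb ω * G.total ω)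
    fun σ τ => Finset.sum_congr rfl fun ω _ => ?_
  rw [playProb_eq]
  ring

theorem hasValue_dualPayoff [NeZero n] [Nonempty K] [Nonempty A] [Nonempty B] (G : Game K A B)
    (α : K → ℝ) : HasValue (G.dualPayoff (n := n) α) (G.dualValue n α) := by
  have hc := continuous_plan₁ (K := K) (A := A) (B := B) (n := n)
  have : Nonempty (stdSimplex ℝ K) := ⟨pointMass (Classical.arbitrary K)⟩
  refine hasValue_of_bilinear
    (x := fun (s : stdSimplex ℝ K × Strategy₁ K A B n) (ω : Play K A B n) =>
      s.1.1 (ω 0).1 * plan₁ s.2 ω)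
    (continuous_pi fun ω =>
      ((continuous_apply _).comp (continuous_subtype_val.comp continuous_fst)).mul
        ((continuous_apply ω).comp (hc.comp continuous_snd)))
    continuous_plan₂
    convex_range_dualPlan₁ convex_range_plan₂
    (fun ω => G.transProb ω * (α (ω 0).1 + G.total ω))
    fun s τ => Finset.sum_congr rfl fun ω _ => ?_
  rw [playProb_eq]
  ring

/-! ### Duality -/

theorem iInf_dualPayoff [NeZero n] [Nonempty A] [Nonempty B] (G : Game K A B) (α : K → ℝ)
    (p : stdSimplex ℝ K) (σ : Strategy₁ K A B n) :
    ⨅ τ, G.dualPayoff α (p, σ) τ = (⨅ τ, G.payoff p σ τ) + p.1 ⬝ᵥ α := by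
  simp only [dualPayoff_eq]
  rw [ciInf_add ((G.hasValue_payoff p).bddBelow σ)]

theorem isGreatest_dualValue [NeZero n] [Nonempty K] [Nonempty A] [Nonempty B]
    (G : Game K A B) (α : K → ℝ) :
    IsGreatest (range fun p : stdSimplex ℝ K => G.value n p + p.1 ⬝ᵥ α) (G.dualValue n α) := by
  have hle : ∀ p : stdSimplex ℝ K, G.value n p + p.1 ⬝ᵥ α ≤ G.dualValue n α := fun p => by
    obtain ⟨σ, hσ⟩ := (G.hasValue_payoff (n := n) p).maxmin.1
    have h := (G.hasValue_dualPayoff α).maxmin.2 ⟨(p, σ), rfl⟩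
    simp only [iInf_dualPayoff] at h
    exact hσ ▸ h
  refine ⟨?_, by rintro _ ⟨p, rfl⟩; exact hle p⟩
  obtain ⟨⟨p, σ⟩, hs⟩ := (G.hasValue_dualPayoff (n := n) α).maxmin.1
  refine ⟨p, le_antisymm (hle p) ?_⟩
  simp only [iInf_dualPayoff] at hs
  have h := (G.hasValue_payoff (n := n) p).maxmin.2 ⟨σ, rfl⟩
  simp only at h ⊢
  linarith

/-- Plays starting outside `k` have probability zero. This lets the best replies in the separate
initial states be pasted into one strategy. -/
theorem payoff_pointMass_congr [NeZero n] (G : Game K A B) (k : K) (τ : Strategy₂ A B n)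
    (σ : K → Strategy₁ K A B n) :
    G.payoff (pointMass k) (fun t s => σ (s 0) t s) τ = G.payoff (pointMass k) (σ k) τ := by
  refine Finset.sum_congr rfl fun ω _ => ?_
  by_cases h : (ω 0).1 = k
  · subst h
    rfl
  · rw [playProb_pointMass_of_ne G _ τ h, playProb_pointMass_of_ne G _ τ h]

/-- The informed player can maximize separately in every initial state. -/
theorem iSup_payoff [NeZero n] [Nonempty A] [Nonempty B] (G : Game K A B)
    (p : stdSimplex ℝ K) (τ : Strategy₂ A B n) :
    ⨆ σ, G.payoff p σ τ = -(p.1 ⬝ᵥ G.regret τ) := by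
  have hreg : -(p.1 ⬝ᵥ G.regret τ) = ∑ k, p.1 k * ⨆ σ, G.payoff (pointMass k) σ τ := by
    simp [dotProduct, regret]
  rw [hreg]
  refine le_antisymm (ciSup_le fun σ => ?_) ?_
  · rw [payoff, expect_eq_sum_pointMass]
    exact Finset.sum_le_sum fun k _ => mul_le_mul_of_nonneg_left
      (le_ciSup ((G.hasValue_payoff (pointMass k)).bddAbove τ) σ) (p.2.1 k)
  · choose σ hσ using fun k => (G.hasValue_payoff (n := n) (pointMass k)).max_attained τ
    refine le_trans (le_of_eq ?_) (le_ciSup ((G.hasValue_payoff p).bddAbove τ)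
      fun t s => σ (s 0) t s)
    rw [payoff, expect_eq_sum_pointMass]
    refine Finset.sum_congr rfl fun k _ => congrArg _ ?_
    refine Eq.trans ?_ (payoff_pointMass_congr G k τ σ).symm
    exact le_antisymm (ciSup_le fun σ' => hσ k (mem_univ σ'))
      (le_ciSup ((G.hasValue_payoff (pointMass k)).bddAbove τ) (σ k))

/-- At a maximizing `p` the dual value is `v(p) + p ⬝ᵥ G.regret τ`, while `τ` itself holds `v(p)`
down to `-(p ⬝ᵥ G.regret τ)`. -/
theorem dualValue_regret_nonpos [NeZero n] [Nonempty K] [Nonempty A] [Nonempty B]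
    (G : Game K A B) (τ : Strategy₂ A B n) : G.dualValue n (G.regret τ) ≤ 0 := by
  obtain ⟨p, hp⟩ := (G.isGreatest_dualValue (n := n) (G.regret τ)).1
  have h := (G.hasValue_payoff (n := n) p).minmax.2 ⟨τ, rfl⟩
  simp only [iSup_payoff] at h hp
  linarith

theorem dualValue_regret_sub_le [NeZero n] [Nonempty K] [Nonempty A] [Nonempty B]
    (G : Game K A B) (p : stdSimplex ℝ K) {τ : Strategy₂ A B n}
    (hτ : IsMinimizerSecurity (G.payoff p) τ) :
    G.dualValue n (G.regret τ) - p.1 ⬝ᵥ G.regret τ ≤ G.value n p := by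
  have h := G.dualValue_regret_nonpos τ
  rw [IsMinimizerSecurity, iSup_payoff, (G.hasValue_payoff p).upperValue_eq] at hτ
  linarith

theorem value_le_dualValue_sub [NeZero n] [Nonempty K] [Nonempty A] [Nonempty B]
    (G : Game K A B) (p : stdSimplex ℝ K) (α : K → ℝ) :
    G.value n p ≤ G.dualValue n α - p.1 ⬝ᵥ α :=
  le_sub_iff_add_le.2 ((G.isGreatest_dualValue α).2 ⟨p, rfl⟩)

theorem isLeast_value [NeZero n] [Nonempty K] [Nonempty A] [Nonempty B] (G : Game K A B)
    (p : stdSimplex ℝ K) :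
    IsLeast (range fun α : K → ℝ => G.dualValue n α - p.1 ⬝ᵥ α) (G.value n p) := by
  have hv := G.hasValue_payoff (n := n) p
  -- A security strategy exists, and its regret is the minimizer; no separation argument is needed.
  obtain ⟨τ, hτ⟩ := hv.minmax.1
  exact ⟨⟨G.regret τ, le_antisymm
      (G.dualValue_regret_sub_le p (hτ.trans hv.upperValue_eq.symm))
      (G.value_le_dualValue_sub p _)⟩,
    by rintro _ ⟨α, rfl⟩; exact G.value_le_dualValue_sub p α⟩

end Game

end AsymGame

theorem mainTheorem3 {K A B : Type*} [Fintype K] [Nonempty K] [Fintype A] [Nonempty A]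
    [Fintype B] [Nonempty B] (G : AsymGame.Game K A B) (n : ℕ) [NeZero n] :
    (∀ p : stdSimplex ℝ K, AsymGame.HasValue (G.payoff (n := n) p) (G.value n p)) ∧
    (∀ α : K → ℝ, AsymGame.HasValue (G.dualPayoff (n := n) α) (G.dualValue n α)) ∧
    (∀ p : stdSimplex ℝ K,
      IsLeast (Set.range fun α : K → ℝ => G.dualValue n α - p.1 ⬝ᵥ α) (G.value n p)) ∧
    (∀ α : K → ℝ,
      IsGreatest (Set.range fun p : stdSimplex ℝ K => G.value n p + p.1 ⬝ᵥ α)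
        (G.dualValue n α)) ∧
    (∀ (p : stdSimplex ℝ K) (τ : AsymGame.Strategy₂ A B n),
      AsymGame.IsMinimizerSecurity (G.payoff p) τ →
        IsMinOn (fun α : K → ℝ => G.dualValue n α - p.1 ⬝ᵥ α) Set.univ (G.regret τ)) :=
  ⟨G.hasValue_payoff, G.hasValue_dualPayoff, G.isLeast_value, G.isGreatest_dualValue,
    fun p _ hτ α _ => (G.dualValue_regret_sub_le p hτ).trans (G.value_le_dualValue_sub p α)⟩
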